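/- Let $\Gamma$ be a finite simple connected graph with $n$ vertices and $E$ edges, exactly two of which, $x\neq y$, are red (negative weight), while all other edges are black and have weight $1$. Let $c=E-n+1$ be its co-rank. For $a,b\in\{0,1\}$ let $A_{ab}$ be the number of spanning trees of $\Gamma$ that contain $x$ if and only if $a=1$ and contain $y$ if and only if $b=1$. (If the red edges have weights $-X$ and $-Y$, the crossing polynomial of $\Gamma$, i.e. the sum over the spanning trees of the products of their edge weights, is $A_{11}XY-A_{10}X-A_{01}Y+A_{00}$.) Let $$\Delta=A_{11}A_{00}-A_{01}A_{10}$$ be its discriminant. Suppose that removing $x$ and $y$ does not disconnect $\Gamma$. Orient the edges of $\Gamma$ arbitrarily, so that every cycle becomes an integer vector indexed by the edges. Let $v_1,\dots,v_{c-2}$ be an integral cycle basis (a $\mathbb Z$-basis of the lattice of integral cycles, i.e. of $H_1(\,\cdot\,;\mathbb Z)$) of the graph with $x$ and $y$ removed, let $v_{c-1}$ be the vector of any (simple) cycle of $\Gamma$ through $x$ but not through $y$, and let $v_c$ be the vector of any (simple) cycle of $\Gamma$ through $y$ but not through $x$. Then $v_1,\dots,v_c$ is an integral cycle basis of $\Gamma$.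 Moreover, let $F$ be the $c\times E$ matrix with rows $v_1,\dots,v_c$, and let $M_c^{c-1}$ be the minor (determinant) of $FF^t$ obtained by deleting the $c$-th row and the $(c-1)$-st column. Then $$\Delta=-\bigl(M_c^{c-1}\bigr)^2 .$$ -/

import Mathlib

/-- A weighted graph on the vertex set `V`: a symmetric array of real weights `γ i j` with no loops.
The edges are the pairs of nonzero weight; an edge is black if its weight is positive and red if
its weight is negative. -/
structure WeightedGraph (V : Type*) where
  γ : V → V → ℝ
  symm : ∀ i j, γ i j = γ j i
  loopless : ∀ i, γ i i = 0

namespace WeightedGraph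

variable {V : Type*}

/-- The underlying simple graph. -/
def graph (Γ : WeightedGraph V) : SimpleGraph V where
  Adj i j := Γ.γ i j ≠ 0
  symm := ⟨fun i j h => by rw [Γ.symm j i]; exact h⟩
  loopless := ⟨fun i h => h (Γ.loopless i)⟩

/-- The weight of an unordered pair of vertices. -/
def weight (Γ : WeightedGraph V) : Sym2 V → ℝ :=
  Sym2.lift ⟨Γ.γ, Γ.symm⟩

/-- The product of the weights of the black edges of a subgraph `T`. -/
noncomputable def blackProduct [Fintype V] (Γ : WeightedGraph V) (T : SimpleGraph V) : ℝ :=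
  open Classical in ∏ e ∈ T.edgeFinset with 0 < Γ.weight e, Γ.weight e

/-- `T` is a spanning tree of `Γ` (on the whole vertex set) which contains every edge in `I` and
no edge in `J`. -/
def IsSpanningTreeWith (Γ : WeightedGraph V) (I J : Set (Sym2 V)) (T : SimpleGraph V) : Prop :=
  T ≤ Γ.graph ∧ T.IsTree ∧ I ⊆ T.edgeSet ∧ Disjoint J T.edgeSet

/-- The sum, over the spanning trees of `Γ` which contain every edge in `I` and no edge in `J`, of
the product of the weights of their black edges. -/
noncomputable def treeSum [Fintype V] (Γ : WeightedGraph V) (I J : Set (Sym2 V)) : ℝ :=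
  open Classical in
    ∑ T : SimpleGraph V with Γ.IsSpanningTreeWith I J T, Γ.blackProduct T

/-- For a weighted graph whose red edges are `x` and `y`, the discriminant
`A₁₁ A₀₀ - A₀₁ A₁₀` of its crossing polynomial `A₁₁ X Y - A₁₀ X - A₀₁ Y + A₀₀`. -/
noncomputable def discriminant [Fintype V] (Γ : WeightedGraph V) (x y : Sym2 V) : ℝ :=
  Γ.treeSum {x, y} ∅ * Γ.treeSum ∅ {x, y} - Γ.treeSum {y} {x} * Γ.treeSum {x} {y}

end WeightedGraph

/-- An orientation of the edges of a simple graph: a choice of source and target for each edge. -/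
structure EdgeOrientation {V : Type*} (G : SimpleGraph V) where
  src : G.edgeSet → V
  tgt : G.edgeSet → V
  mk_eq : ∀ e, s(src e, tgt e) = (e : Sym2 V)

namespace EdgeOrientation

variable {V : Type*} {G : SimpleGraph V}

/-- The boundary map from integral 1-chains to integral 0-chains; it sends an edge to its target
minus its source. -/
noncomputable def boundary [Fintype G.edgeSet] (o : EdgeOrientation G) :
    (G.edgeSet → ℤ) →ₗ[ℤ] (V → ℤ) :=
  open Classical in
    ∑ e, (LinearMap.proj e).smulRight
      (Pi.single (o.tgt e) (1 : ℤ) - Pi.single (o.src e) (1 : ℤ))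

/-- The integral cycles (the first integral homology) of a subgraph `H` of `G`, as 1-chains of `G`
which vanish on every edge outside `H`. -/
noncomputable def cycleLattice [Fintype G.edgeSet] (o : EdgeOrientation G) (H : SimpleGraph V) :
    Submodule ℤ (G.edgeSet → ℤ) where
  carrier := {f | o.boundary f = 0 ∧ ∀ e : G.edgeSet, (e : Sym2 V) ∉ H.edgeSet → f e = 0}
  add_mem' := fun ha hb => ⟨by rw [map_add, ha.1, hb.1, add_zero],
    fun e he => by rw [Pi.add_apply, ha.2 e he, hb.2 e he, add_zero]⟩
  zero_mem' := ⟨map_zero _, fun _ _ => rfl⟩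
  smul_mem' := fun c f hf => ⟨by rw [map_smul, hf.1, smul_zero],
    fun e he => by rw [Pi.smul_apply, hf.2 e he, smul_zero]⟩

/-- The family `v` is an (integral) cycle basis of the subgraph `H` of `G`. -/
def IsCycleBasis [Fintype G.edgeSet] (o : EdgeOrientation G) (H : SimpleGraph V) {ι : Type*}
    (v : ι → G.edgeSet → ℤ) : Prop :=
  LinearIndependent ℤ v ∧ Submodule.span ℤ (Set.range v) = o.cycleLattice H

/-- The 1-chain of a walk: the coefficient of an edge is the number of times that the walk
traverses it along its orientation minus the number of times that it traverses it against its
orientation. -/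
noncomputable def chain (o : EdgeOrientation G) {a b : V} (p : G.Walk a b) : G.edgeSet → ℤ :=
  open Classical in fun e =>
    (p.darts.countP (fun d => d.fst = o.src e ∧ d.snd = o.tgt e) : ℤ) -
      (p.darts.countP (fun d => d.fst = o.tgt e ∧ d.snd = o.src e) : ℤ)

end EdgeOrientation

/-- The minor of a square matrix obtained by deleting the row `i` and the column `j`. -/
def deletedMinor {n : ℕ} (A : Matrix (Fin (n + 1)) (Fin (n + 1)) ℤ) (i j : Fin (n + 1)) : ℤ :=
  (A.submatrix i.succAbove j.succAbove).det

/-! Write τ for the number of spanning trees. Sorting trees by whether they contain x and y gives Δ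
= τ(Γ)τ(Γ−x−y) − τ(Γ−x)τ(Γ−y) (`discriminant_eq`). Each τ is the Gram determinant of an integral
cycle basis (`IsCycleBasis.det_mul_transpose`): in Cauchy–Binet, a maximal minor of the basis is ±1
on the complement of a spanning tree and 0 otherwise. A simple cycle through a red edge has
coefficient ±1 there, so adjoining it to a cycle basis of the graph without that edge gives a cycle
basis of the graph with it (`IsCycleBasis.of_deleteEdges`). Hence the four Gram matrices are FFᵗ and
its principal submatrices omitting row and column c−1, c, or both. The Desnanot–Jacobi identity
turns Δ into minus the product of the two off-diagonal minors, which agree because FFᵗ is symmetric.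
-/

namespace Matrix

/-! ### Determinant identities: Cauchy–Binet and Desnanot–Jacobi. -/

/-- A symmetrised form of the Cauchy–Binet formula. -/
theorem factorial_mul_det_mul {ι κ R : Type*} [Fintype ι] [DecidableEq ι] [Fintype κ]
    [CommRing R] (B : Matrix ι κ R) (C : Matrix κ ι R) :
    ((Fintype.card ι).factorial : R) * (B * C).det =
      ∑ f : ι → κ, (B.submatrix id f).det * (C.submatrix f id).det := by
  classical
  have expand : (B * C).det = ∑ f : ι → κ, (∏ i, B i (f i)) * (C.submatrix f id).det := by
    have rows : B * C = fun i => ∑ e, B i e • C e := by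
      ext i j
      simp [mul_apply, Finset.sum_apply]
    rw [rows]
    refine ((detRowAlternating (n := ι) (R := R)).toMultilinearMap.map_sum
      (fun i e => B i e • C e)).trans ?_
    refine Finset.sum_congr rfl fun f _ => ?_
    exact (detRowAlternating (n := ι) (R := R)).toMultilinearMap.map_smul_univ
      (fun i => B i (f i)) (fun i => C (f i))
  -- Replacing `f` by `f ∘ σ` permutes the rows of the minor of `C` at the cost of a sign; summing
  -- over all `σ` assembles the minor of `B`.
  have permuted (σ : Equiv.Perm ι) : (B * C).det =
      ∑ f : ι → κ, ((Equiv.Perm.sign σ : ℤ) : R) * (∏ i, B i (f (σ i))) *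
        (C.submatrix f id).det := by
    rw [expand, ← (Equiv.arrowCongr σ.symm (Equiv.refl κ)).sum_comp]
    refine Finset.sum_congr rfl fun f _ => ?_
    have : C.submatrix ((Equiv.arrowCongr σ.symm (Equiv.refl κ)) f) id =
        (C.submatrix f id).submatrix σ id := rfl
    rw [this, det_permute]
    simp only [Equiv.arrowCongr_apply, Equiv.coe_refl, Function.comp_apply, id_eq,
      Equiv.symm_symm]
    ring
  have count : ((Fintype.card ι).factorial : R) * (B * C).det =
      ∑ _σ : Equiv.Perm ι, (B * C).det := by
    simp [Fintype.card_perm]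
  rw [count, Finset.sum_congr rfl fun σ _ => permuted σ, Finset.sum_comm]
  refine Finset.sum_congr rfl fun f _ => ?_
  rw [← Finset.sum_mul, ← det_transpose (B.submatrix id f), det_apply' (B.submatrix id f)ᵀ]
  rfl

/-- Jacobi's identity for the complementary minors of the adjugate matrix. -/
theorem det_mul_det_toBlocks₂₂_adjugate {m n R : Type*} [Fintype m] [Fintype n] [DecidableEq m]
    [DecidableEq n] [CommRing R] (A : Matrix (m ⊕ n) (m ⊕ n) R) :
    A.det * A.adjugate.toBlocks₂₂.det = A.det ^ Fintype.card n * A.toBlocks₁₁.det := by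
  -- The second block column of the right factor is that of the adjugate, so `A` sends it to `A.det`
  -- times that of the identity.
  have key : A * fromBlocks 1 A.adjugate.toBlocks₁₂ 0 A.adjugate.toBlocks₂₂ =
      fromBlocks A.toBlocks₁₁ 0 A.toBlocks₂₁ (A.det • (1 : Matrix n n R)) := by
    ext i (j | j)
    · rcases i with i | i <;>
        simp [mul_apply, toBlocks₁₁, toBlocks₂₁, Matrix.one_apply]
    · have h := congrFun (congrFun A.mul_adjugate i) (Sum.inr j)
      rcases i with i | i <;>
        simpa [mul_apply, toBlocks₁₂, toBlocks₂₂, Matrix.one_apply] using h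
  have h := congrArg det key
  rw [det_mul, det_fromBlocks_zero₂₁, det_fromBlocks_zero₁₂, det_one, one_mul, det_smul, det_one,
    mul_one, mul_comm A.toBlocks₁₁.det] at h
  exact h

/-- The Desnanot–Jacobi identity. -/
theorem det_mul_det_submatrix_castSucc_castSucc {k : ℕ} {R : Type*} [CommRing R] [IsDomain R]
    (A : Matrix (Fin (k + 2)) (Fin (k + 2)) R) (hA : A.det ≠ 0) :
    A.det * (A.submatrix (fun i : Fin k => i.castSucc.castSucc)
        (fun i : Fin k => i.castSucc.castSucc)).det =
      (A.submatrix (Fin.last k).castSucc.succAbove (Fin.last k).castSucc.succAbove).det *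
          (A.submatrix (Fin.last (k + 1)).succAbove (Fin.last (k + 1)).succAbove).det -
        (A.submatrix (Fin.last (k + 1)).succAbove (Fin.last k).castSucc.succAbove).det *
          (A.submatrix (Fin.last k).castSucc.succAbove (Fin.last (k + 1)).succAbove).det := by
  have h := det_mul_det_toBlocks₂₂_adjugate (A.submatrix finSumFinEquiv finSumFinEquiv)
  rw [det_submatrix_equiv_self, adjugate_submatrix_equiv_self, Fintype.card_fin, sq, mul_assoc] at h
  have h := (mul_left_cancel₀ hA h).symm
  have h0 : (finSumFinEquiv (Sum.inr 0 : Fin k ⊕ Fin 2)) = (Fin.last k).castSucc := rfl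
  have h1 : (finSumFinEquiv (Sum.inr 1 : Fin k ⊕ Fin 2)) = Fin.last (k + 1) := rfl
  refine Eq.trans h ?_
  rw [det_fin_two]
  simp only [toBlocks₂₂, of_apply, submatrix_apply, h0, h1, adjugate_fin_succ_eq_det_submatrix,
    Fin.val_last, Fin.val_castSucc]
  have e1 : ((-1 : R) ^ (k + k)) = 1 := Even.neg_one_pow ⟨k, rfl⟩
  have e2 : ((-1 : R) ^ (k + 1 + (k + 1))) = 1 := Even.neg_one_pow ⟨k + 1, rfl⟩
  have e3 : ((-1 : R) ^ (k + 1 + k)) = -1 := Odd.neg_one_pow ⟨k, by ring⟩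
  have e4 : ((-1 : R) ^ (k + (k + 1))) = -1 := Odd.neg_one_pow ⟨k, by ring⟩
  rw [e1, e2, e3, e4]
  ring

end Matrix

/-! ### Chains of walks and cycle lattices. -/

namespace EdgeOrientation

variable {V : Type*} {G : SimpleGraph V} (o : EdgeOrientation G)

theorem src_ne_tgt (e : G.edgeSet) : o.src e ≠ o.tgt e := by
  have h := e.2
  rw [← o.mk_eq e, SimpleGraph.mem_edgeSet] at h
  exact h.ne

open Classical in
theorem countP_darts_add_countP_darts {a b : V} (p : G.Walk a b) (e : G.edgeSet) :
    p.darts.countP (fun d => d.fst = o.src e ∧ d.snd = o.tgt e) +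
      p.darts.countP (fun d => d.fst = o.tgt e ∧ d.snd = o.src e) =
        p.edges.count (e : Sym2 V) := by
  induction p with
  | nil => simp
  | @cons u v w h p ih =>
    have hne := o.src_ne_tgt e
    have hmk := o.mk_eq e
    simp only [SimpleGraph.Walk.darts_cons, SimpleGraph.Walk.edges_cons, List.countP_cons,
      List.count_cons, ← ih]
    have h1 : (s(u, v) == (e : Sym2 V)) =
        (decide (u = o.src e ∧ v = o.tgt e) || decide (u = o.tgt e ∧ v = o.src e)) := by
      rw [← hmk, Bool.eq_iff_iff]
      simp
    rw [h1]
    by_cases c1 : u = o.src e ∧ v = o.tgt e <;> by_cases c2 : u = o.tgt e ∧ v = o.src e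
    · exact absurd (c1.1.symm.trans c2.1) hne
    all_goals simp [c1, c2, hne, hne.symm]; try omega

theorem chain_eq_zero {a b : V} (p : G.Walk a b) (e : G.edgeSet) (he : (e : Sym2 V) ∉ p.edges) :
    o.chain p e = 0 := by
  classical
  have h := o.countP_darts_add_countP_darts p e
  rw [List.count_eq_zero_of_not_mem he] at h
  unfold chain
  omega

/-- A trail traverses an edge at most once, so the coefficient is ±1. -/
theorem isUnit_chain {a b : V} (p : G.Walk a b) (hp : p.IsTrail) (e : G.edgeSet)
    (he : (e : Sym2 V) ∈ p.edges) : IsUnit (o.chain p e) := by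
  classical
  have h := o.countP_darts_add_countP_darts p e
  rw [List.count_eq_one_of_mem hp.edges_nodup he] at h
  rw [Int.isUnit_iff]
  unfold chain
  omega

variable [Fintype G.edgeSet]

open Classical in
theorem boundary_apply (f : G.edgeSet → ℤ) :
    o.boundary f = ∑ e, f e • (Pi.single (o.tgt e) (1 : ℤ) - Pi.single (o.src e) (1 : ℤ)) := by
  simp [boundary, LinearMap.sum_apply]

open Classical in
theorem boundary_single (e : G.edgeSet) :
    o.boundary (Pi.single e 1) = Pi.single (o.tgt e) (1 : ℤ) - Pi.single (o.src e) (1 : ℤ) := by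
  rw [boundary_apply, Finset.sum_eq_single e]
  · simp
  · intro e' _ h
    simp [h]
  · simp

open Classical in
theorem boundary_chain {a b : V} (p : G.Walk a b) :
    o.boundary (o.chain p) = Pi.single b (1 : ℤ) - Pi.single a (1 : ℤ) := by
  induction p with
  | @nil u =>
    have : o.chain (SimpleGraph.Walk.nil : G.Walk u u) = 0 := by
      ext e
      simp [chain]
    simp [this]
  | @cons u v w h p ih =>
    set e : G.edgeSet := ⟨s(u, v), h⟩ with he
    -- Here `ε` is 1 or −1 according to whether the first step follows the orientation of `e`.
    have step : ∃ ε : ℤ, o.chain (SimpleGraph.Walk.cons h p) = o.chain p + ε • Pi.single e 1 ∧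
        ε • (Pi.single (o.tgt e) (1 : ℤ) - Pi.single (o.src e) (1 : ℤ)) =
          (Pi.single v (1 : ℤ) - Pi.single u (1 : ℤ) : V → ℤ) := by
      have hother (e' : G.edgeSet) (hne : e' ≠ e) :
          o.chain (SimpleGraph.Walk.cons h p) e' = o.chain p e' := by
        have h1 : ¬ (u = o.src e' ∧ v = o.tgt e') := by
          rintro ⟨rfl, rfl⟩
          exact hne (Subtype.ext (o.mk_eq e').symm)
        have h2 : ¬ (u = o.tgt e' ∧ v = o.src e') := by
          rintro ⟨rfl, rfl⟩
          exact hne (Subtype.ext ((o.mk_eq e').symm.trans Sym2.eq_swap))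
        simp [chain, h1, h2]
      have hmk : s(o.src e, o.tgt e) = s(u, v) := o.mk_eq e
      rcases Sym2.eq_iff.1 hmk with ⟨hs, ht⟩ | ⟨hs, ht⟩
      · refine ⟨1, ?_, by simp [hs, ht]⟩
        ext e'
        by_cases hne : e' = e
        · subst hne
          simp [chain, hs, ht, h.ne]
          ring
        · simp [hother e' hne, hne]
      · refine ⟨-1, ?_, by simp [hs, ht]⟩
        ext e'
        by_cases hne : e' = e
        · subst hne
          simp [chain, hs, ht, h.ne]
          ring
        · simp [hother e' hne, hne]
    obtain ⟨ε, h1, h2⟩ := step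
    rw [h1, map_add, map_smul, boundary_single, h2, ih]
    abel

theorem chain_mem_cycleLattice {a : V} (p : G.Walk a a) (H : SimpleGraph V)
    (hp : ∀ e ∈ p.edges, e ∈ H.edgeSet) : o.chain p ∈ o.cycleLattice H :=
  ⟨by rw [boundary_chain, sub_self], fun e he => o.chain_eq_zero p e fun h => he (hp _ h)⟩

/-- The fundamental cycle of an edge with respect to a connected subgraph. -/
theorem exists_mem_cycleLattice_of_connected {H T : SimpleGraph V} (hHG : H ≤ G) (hTH : T ≤ H)
    (hT : T.Connected) (e : G.edgeSet) (he : (e : Sym2 V) ∈ H.edgeSet) :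
    ∃ z ∈ o.cycleLattice H, ∀ e' : G.edgeSet, (e' : Sym2 V) ∉ T.edgeSet →
      z e' = open Classical in if e' = e then 1 else 0 := by
  classical
  obtain ⟨p⟩ := hT.preconnected (o.tgt e) (o.src e)
  set q := p.mapLe (hTH.trans hHG) with hq
  have hzero (e' : G.edgeSet) (he' : (e' : Sym2 V) ∉ T.edgeSet) : o.chain q e' = 0 := by
    refine o.chain_eq_zero q e' fun h => he' (p.edges_subset_edgeSet ?_)
    simpa [hq] using h
  -- Traverse `e` once and return from its target to its source inside `T`.
  refine ⟨o.chain q + Pi.single e 1, ⟨?_, ?_⟩, ?_⟩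
  · rw [map_add, boundary_chain, boundary_single]
    abel
  · intro e' he'
    have hne : e' ≠ e := by
      rintro rfl
      exact he' he
    have := hzero e' fun h => he' (SimpleGraph.edgeSet_mono hTH h)
    simp [this, hne]
  · intro e' he'
    simp [hzero e' he', Pi.single_apply]

/-- A subgraph which contains a cycle has a nonzero cycle lattice. -/
theorem exists_ne_zero_mem_cycleLattice {T : SimpleGraph V} (hTG : T ≤ G) (hT : ¬ T.IsAcyclic) :
    ∃ z ∈ o.cycleLattice T, z ≠ 0 := by
  simp only [SimpleGraph.IsAcyclic, not_forall, not_not] at hT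
  obtain ⟨v, p, hp⟩ := hT
  have hedges : (p.mapLe hTG).edges = p.edges := by simp
  refine ⟨o.chain (p.mapLe hTG), o.chain_mem_cycleLattice _ _ fun e he => ?_, fun h0 => ?_⟩
  · rw [hedges] at he
    exact p.edges_subset_edgeSet he
  · obtain ⟨e, he⟩ := List.exists_mem_of_ne_nil p.edges (by
      intro h
      have := hp.three_le_length
      rw [← p.length_edges, h] at this
      simp at this)
    have hu := o.isUnit_chain (p.mapLe hTG) (hp.mapLe hTG).isTrail
      ⟨e, SimpleGraph.edgeSet_mono hTG (p.edges_subset_edgeSet he)⟩ (by rwa [hedges])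
    rw [h0] at hu
    exact not_isUnit_zero hu

/-- Evaluation at `e` kills every row but the last, where it is a unit; so an integer multiple of
the last row clears the `e`-coefficient of any cycle of `H`. -/
theorem IsCycleBasis.of_deleteEdges {o : EdgeOrientation G} {H : SimpleGraph V} {n : ℕ}
    {v : Fin (n + 1) → G.edgeSet → ℤ} (e : G.edgeSet)
    (hv : o.IsCycleBasis (H.deleteEdges {(e : Sym2 V)}) (fun i : Fin n => v i.castSucc))
    (hlast : v (Fin.last n) ∈ o.cycleLattice H) (hunit : IsUnit (v (Fin.last n) e)) :
    o.IsCycleBasis H v := by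
  have hmem (i : Fin n) : v i.castSucc ∈ o.cycleLattice (H.deleteEdges {(e : Sym2 V)}) := by
    rw [← hv.2]
    exact Submodule.subset_span ⟨i, rfl⟩
  have hle : o.cycleLattice (H.deleteEdges {(e : Sym2 V)}) ≤ o.cycleLattice H :=
    fun z hz => ⟨hz.1, fun e' he' => hz.2 e' fun h =>
      he' (SimpleGraph.edgeSet_mono (SimpleGraph.deleteEdges_le _) h)⟩
  have hzero (z) (hz : z ∈ o.cycleLattice (H.deleteEdges {(e : Sym2 V)})) : z e = 0 :=
    hz.2 e (by simp [SimpleGraph.edgeSet_deleteEdges])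
  constructor
  · rw [Fintype.linearIndependent_iff]
    intro g hg
    rw [Fin.sum_univ_castSucc] at hg
    have h0 : g (Fin.last n) = 0 := by
      have h := congrFun hg e
      simp only [Pi.add_apply, Finset.sum_apply, Pi.smul_apply, Pi.zero_apply] at h
      rw [Finset.sum_eq_zero fun i _ => by rw [hzero _ (hmem i), smul_zero], zero_add,
        smul_eq_mul] at h
      exact (mul_eq_zero.1 h).resolve_right hunit.ne_zero
    rw [h0, zero_smul, add_zero] at hg
    have h := Fintype.linearIndependent_iff.1 hv.1 (fun i => g i.castSucc) hg
    intro i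
    refine Fin.lastCases h0 h i
  · refine le_antisymm (Submodule.span_le.2 ?_) fun z hz => ?_
    · rintro _ ⟨i, rfl⟩
      exact Fin.lastCases hlast (fun i => hle (hmem i)) i
    · obtain ⟨u, hu⟩ := hunit
      set c : ℤ := z e * (↑u⁻¹ : ℤ) with hc
      have hw : z - c • v (Fin.last n) ∈ o.cycleLattice (H.deleteEdges {(e : Sym2 V)}) := by
        have hw' := Submodule.sub_mem _ hz (Submodule.smul_mem _ c hlast)
        refine ⟨hw'.1, fun e' he' => ?_⟩
        by_cases hee : e' = e
        · subst hee
          simp [hc, ← hu, mul_assoc]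
        · refine hw'.2 e' fun h => he' ?_
          rw [SimpleGraph.edgeSet_deleteEdges]
          exact ⟨h, fun h' => hee (Subtype.ext h')⟩
      rw [← hv.2] at hw
      have hw2 : z - c • v (Fin.last n) ∈ Submodule.span ℤ (Set.range v) :=
        Submodule.span_mono (by rintro _ ⟨i, rfl⟩; exact ⟨_, rfl⟩) hw
      have := Submodule.add_mem _ hw2
        (Submodule.smul_mem _ c (Submodule.subset_span ⟨Fin.last n, rfl⟩))
      simpa using this

end EdgeOrientation

/-! ### Counting spanning trees. -/

namespace SimpleGraph

variable {V : Type*} [Fintype V]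

/-- The number of spanning trees of a graph. -/
noncomputable def numSpanningTrees (H : SimpleGraph V) : ℕ :=
  open Classical in Finset.card {T : SimpleGraph V | T ≤ H ∧ T.IsTree}

theorem Connected.numSpanningTrees_pos {H : SimpleGraph V} (h : H.Connected) :
    0 < H.numSpanningTrees := by
  classical
  obtain ⟨T, hT⟩ := h.exists_isTree_le
  exact Finset.card_pos.2 ⟨T, by simpa using hT⟩

theorem IsTree.ncard_edgeSet {T : SimpleGraph V} (hT : T.IsTree) :
    T.edgeSet.ncard + 1 = Fintype.card V := by
  have := (isTree_iff_connected_and_card.1 hT).2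
  rwa [Nat.card_coe_set_eq, Nat.card_eq_fintype_card] at this

/-- An acyclic subgraph of a connected graph which has enough edges is a spanning tree. -/
theorem IsAcyclic.isTree_of_ncard_edgeSet {H T : SimpleGraph V} (hH : H.Connected) (hTH : T ≤ H)
    (hT : T.IsAcyclic) (hcard : Fintype.card V ≤ T.edgeSet.ncard + 1) : T.IsTree := by
  obtain ⟨T', hle, -, hT'⟩ := hH.exists_isTree_le_of_le_of_isAcyclic hTH hT
  have hn := hT'.ncard_edgeSet
  have := Set.eq_of_subset_of_ncard_le (edgeSet_mono hle) (by omega) (Set.toFinite _)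
  rwa [edgeSet_inj.1 this]

end SimpleGraph

/-! ### Gram determinants of cycle bases count spanning trees. -/

namespace EdgeOrientation

variable {V : Type*} [Fintype V] {G : SimpleGraph V} [Fintype G.edgeSet]
  {o : EdgeOrientation G} {H : SimpleGraph V} {ι : Type*} [Fintype ι] [DecidableEq ι]
  {B : Matrix ι G.edgeSet ℤ}

omit [Fintype V] [DecidableEq ι] in
theorem IsCycleBasis.exists_vecMul_eq (hB : o.IsCycleBasis H (fun i => B i))
    {z : G.edgeSet → ℤ} (hz : z ∈ o.cycleLattice H) : ∃ g : ι → ℤ, Matrix.vecMul g B = z := by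
  rw [← hB.2, Submodule.mem_span_range_iff_exists_fun] at hz
  obtain ⟨g, hg⟩ := hz
  exact ⟨g, by rw [Matrix.vecMul_eq_sum, ← hg]⟩

omit [Fintype V] in
/-- The columns of a cycle basis at the complement of a spanning tree form a unimodular matrix. -/
theorem IsCycleBasis.isUnit_det_submatrix (hB : o.IsCycleBasis H (fun i => B i)) (hHG : H ≤ G)
    {T : SimpleGraph V} (hTH : T ≤ H) (hT : T.Connected) {f : ι → G.edgeSet}
    (hf : Function.Injective f)
    (hrange : ∀ e, e ∈ Set.range f ↔ (e : Sym2 V) ∈ H.edgeSet ∧ (e : Sym2 V) ∉ T.edgeSet) :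
    IsUnit (B.submatrix id f).det := by
  classical
  -- The fundamental cycles of the edges `f j`, expanded in the basis, supply an integral left
  -- inverse.
  have hex (j : ι) : ∃ g : ι → ℤ, ∀ i, Matrix.vecMul g B (f i) = if i = j then 1 else 0 := by
    obtain ⟨z, hz, hz'⟩ := o.exists_mem_cycleLattice_of_connected hHG hTH hT (f j)
      ((hrange _).1 ⟨j, rfl⟩).1
    obtain ⟨g, rfl⟩ := hB.exists_vecMul_eq hz
    exact ⟨g, fun i => by rw [hz' _ ((hrange _).1 ⟨i, rfl⟩).2]; simp [hf.eq_iff]⟩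
  choose g hg using hex
  have hmul : Matrix.of g * B.submatrix id f = 1 := by
    ext j i
    rw [Matrix.one_apply]
    simpa [Matrix.mul_apply, Matrix.vecMul, dotProduct, eq_comm] using hg j i
  have hdet := congrArg Matrix.det hmul
  rw [Matrix.det_mul, Matrix.det_one, mul_comm] at hdet
  exact IsUnit.of_mul_eq_one _ hdet

/-- If a family of columns of a cycle basis is not the complement of a spanning tree, then its
determinant vanishes. -/
theorem IsCycleBasis.det_submatrix_eq_zero (hB : o.IsCycleBasis H (fun i => B i)) (hHG : H ≤ G)
    (hH : H.Connected) (hcard : H.edgeSet.ncard + 1 = Fintype.card V + Fintype.card ι)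
    (f : ι → G.edgeSet)
    (hf : ∀ T ≤ H, T.IsTree → Function.Injective f →
      ¬ ∀ e, e ∈ Set.range f ↔ (e : Sym2 V) ∈ H.edgeSet ∧ (e : Sym2 V) ∉ T.edgeSet) :
    (B.submatrix id f).det = 0 := by
  classical
  by_cases hinj : Function.Injective f
  swap
  · simp only [Function.Injective, not_forall] at hinj
    obtain ⟨i, j, hij, hne⟩ := hinj
    exact Matrix.det_zero_of_column_eq hne fun l => by simp [hij]
  by_cases hfH : ∀ i, (f i : Sym2 V) ∈ H.edgeSet
  swap
  · push Not at hfH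
    obtain ⟨i, hi⟩ := hfH
    refine Matrix.det_eq_zero_of_column_eq_zero i fun l => ?_
    have : B l ∈ o.cycleLattice H := by
      rw [← hB.2]
      exact Submodule.subset_span ⟨l, rfl⟩
    exact this.2 _ hi
  set S : Set (Sym2 V) := Set.range fun i => (f i : Sym2 V) with hS
  have hSH : S ⊆ H.edgeSet := by
    rintro _ ⟨i, rfl⟩
    exact hfH i
  set T := H.deleteEdges S with hT
  have hTH : T ≤ H := SimpleGraph.deleteEdges_le _
  have hTedge : T.edgeSet = H.edgeSet \ S := SimpleGraph.edgeSet_deleteEdges _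
  have hScard : S.ncard = Fintype.card ι := by
    have hval : Function.Injective fun i => (f i : Sym2 V) := Subtype.val_injective.comp hinj
    rw [hS, ← Set.image_univ, Set.ncard_image_of_injective _ hval,
      Set.ncard_univ, Nat.card_eq_fintype_card]
  have hTcard : T.edgeSet.ncard + S.ncard = H.edgeSet.ncard := by
    rw [hTedge]
    exact Set.ncard_sdiff_add_ncard_of_subset hSH
  have hmemS (e : G.edgeSet) : (e : Sym2 V) ∈ S ↔ e ∈ Set.range f := by
    simp [hS, Subtype.ext_iff]
  -- `T` has the edge count of a spanning tree, so it must contain a cycle. That cycle is a nonzero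
  -- combination of the rows vanishing on all the columns `f`.
  have hcyc : ¬ T.IsAcyclic := by
    intro hac
    refine hf T hTH (hac.isTree_of_ncard_edgeSet hH hTH (by omega)) hinj fun e => ?_
    rw [hTedge, Set.mem_sdiff, ← hmemS]
    constructor
    · exact fun h => ⟨hSH h, fun h' => h'.2 h⟩
    · rintro ⟨h1, h2⟩
      by_contra h
      exact h2 ⟨h1, h⟩
  obtain ⟨z, hz, hz0⟩ := o.exists_ne_zero_mem_cycleLattice (hTH.trans hHG) hcyc
  have hzH : z ∈ o.cycleLattice H :=
    ⟨hz.1, fun e he => hz.2 e fun h => he (SimpleGraph.edgeSet_mono hTH h)⟩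
  obtain ⟨g, rfl⟩ := hB.exists_vecMul_eq hzH
  by_contra hdet
  refine hz0 ?_
  have hg : g = 0 := by
    refine Matrix.eq_zero_of_vecMul_eq_zero hdet ?_
    ext i
    have := hz.2 (f i) (by
      rw [hTedge]
      exact fun h => h.2 ⟨i, rfl⟩)
    simpa [Matrix.vecMul, dotProduct] using this
  rw [hg, Matrix.zero_vecMul]

/-- The determinant of the Gram matrix of an integral cycle basis is the number of spanning
trees. -/
theorem IsCycleBasis.det_mul_transpose (hB : o.IsCycleBasis H (fun i => B i)) (hHG : H ≤ G)
    (hH : H.Connected) (hcard : H.edgeSet.ncard + 1 = Fintype.card V + Fintype.card ι) :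
    (B * B.transpose).det = H.numSpanningTrees := by
  classical
  let P (f : ι → G.edgeSet) (T : SimpleGraph V) : Prop := Function.Injective f ∧
    ∀ e, e ∈ Set.range f ↔ (e : Sym2 V) ∈ H.edgeSet ∧ (e : Sym2 V) ∉ T.edgeSet
  let trees : Finset (SimpleGraph V) := {T | T ≤ H ∧ T.IsTree}
  -- A family `f` enumerates the complement of at most one spanning tree.
  have hterm (f : ι → G.edgeSet) :
      (B.submatrix id f).det * (B.transpose.submatrix f id).det =
        ∑ T ∈ trees, if P f T then 1 else 0 := by
    rw [← Matrix.transpose_submatrix, Matrix.det_transpose]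
    by_cases hex : ∃ T ∈ trees, P f T
    · obtain ⟨T, hT, hP⟩ := hex
      have hT' := (Finset.mem_filter.1 hT).2
      rw [Int.isUnit_mul_self (hB.isUnit_det_submatrix hHG hT'.1 hT'.2.connected hP.1 hP.2),
        Finset.sum_eq_single_of_mem T hT, if_pos hP]
      intro T₁ hT₁ hne
      have hT₁' := (Finset.mem_filter.1 hT₁).2
      refine if_neg fun hP₁ => hne (SimpleGraph.edgeSet_inj.1 (Set.ext fun e => ?_))
      by_cases heH : e ∈ H.edgeSet
      · have h1 := hP.2 ⟨e, SimpleGraph.edgeSet_mono hHG heH⟩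
        have h2 := hP₁.2 ⟨e, SimpleGraph.edgeSet_mono hHG heH⟩
        simp only [heH, true_and] at h1 h2
        exact not_iff_not.1 (h2.symm.trans h1)
      · exact ⟨fun h => absurd (SimpleGraph.edgeSet_mono hT₁'.1 h) heH,
          fun h => absurd (SimpleGraph.edgeSet_mono hT'.1 h) heH⟩
    · push Not at hex
      rw [hB.det_submatrix_eq_zero hHG hH hcard f fun T hle hT h1 h2 =>
        hex T (by simp [trees, hle, hT]) ⟨h1, h2⟩, zero_mul,
        Finset.sum_eq_zero fun T hT => if_neg (hex T hT)]
  -- The families for one tree are the orderings of its complement; their number cancels the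
  -- factorial in Cauchy–Binet.
  have hfiber (T : SimpleGraph V) (hT : T ∈ trees) :
      (∑ f : ι → G.edgeSet, if P f T then (1 : ℤ) else 0) = (Fintype.card ι).factorial := by
    have hT' := (Finset.mem_filter.1 hT).2
    let S := {e : G.edgeSet // (e : Sym2 V) ∈ H.edgeSet ∧ (e : Sym2 V) ∉ T.edgeSet}
    have hS : Fintype.card ι = Fintype.card S := by
      have hinj : Function.Injective fun e : S => ((e : G.edgeSet) : Sym2 V) :=
        Subtype.val_injective.comp Subtype.val_injective
      have h1 : (H.edgeSet \ T.edgeSet).ncard = Fintype.card S := by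
        rw [← Nat.card_eq_fintype_card, ← Set.ncard_univ, ← Set.ncard_image_of_injective _ hinj]
        congr 1
        ext e
        constructor
        · exact fun h => ⟨⟨⟨e, SimpleGraph.edgeSet_mono hHG h.1⟩, h⟩, trivial, rfl⟩
        · rintro ⟨s, -, rfl⟩
          exact s.2
      have h2 := Set.ncard_sdiff_add_ncard_of_subset (SimpleGraph.edgeSet_mono hT'.1)
      have h3 := hT'.2.ncard_edgeSet
      omega
    let toEquiv : {f : ι → G.edgeSet // P f T} ≃ (ι ≃ S) :=
      { toFun := fun f => Equiv.ofBijective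
          (fun i => (⟨f.1 i, (f.2.2 _).1 ⟨i, rfl⟩⟩ : S))
          ⟨fun i j h => f.2.1 (congrArg Subtype.val h), fun s => by
            obtain ⟨i, hi⟩ := (f.2.2 s.1).2 s.2
            exact ⟨i, Subtype.ext hi⟩⟩
        invFun := fun σ => ⟨fun i => (σ i).1, Subtype.val_injective.comp σ.injective, fun e =>
          ⟨by rintro ⟨i, rfl⟩; exact (σ i).2, fun h => ⟨σ.symm ⟨e, h⟩, by simp⟩⟩⟩
        left_inv := fun f => rfl
        right_inv := fun σ => by ext; rfl }
    rw [Finset.sum_boole, ← Fintype.card_subtype, Fintype.card_congr toEquiv,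
      Fintype.card_equiv (Fintype.equivOfCardEq hS)]
  have h := Matrix.factorial_mul_det_mul B B.transpose
  rw [Finset.sum_congr rfl fun f _ => hterm f, Finset.sum_comm, Finset.sum_congr rfl hfiber,
    Finset.sum_const, nsmul_eq_mul, mul_comm (Finset.card trees : ℤ)] at h
  exact mul_left_cancel₀ (by exact_mod_cast Nat.factorial_ne_zero _) h

end EdgeOrientation

/-! ### The discriminant in terms of tree counts. -/

namespace WeightedGraph

variable {V : Type*} [Fintype V] (Γ : WeightedGraph V)

theorem treeSum_eq_add (I J : Set (Sym2 V)) (e : Sym2 V) :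
    Γ.treeSum I J = Γ.treeSum (insert e I) J + Γ.treeSum I (insert e J) := by
  classical
  unfold treeSum
  rw [← Finset.sum_filter_add_sum_filter_not _ (fun T : SimpleGraph V => e ∈ T.edgeSet),
    Finset.filter_filter, Finset.filter_filter]
  congr 2 <;> refine Finset.filter_congr fun T _ => ?_ <;>
    simp only [IsSpanningTreeWith,
      Set.insert_subset_iff, Set.disjoint_insert_left] <;> tauto

theorem blackProduct_eq_one (hblack : ∀ e : Γ.graph.edgeSet, 0 < Γ.weight e → Γ.weight e = 1)
    {T : SimpleGraph V} (hT : T ≤ Γ.graph) : Γ.blackProduct T = 1 := by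
  classical
  refine Finset.prod_eq_one fun e he => ?_
  rw [Finset.mem_filter, SimpleGraph.mem_edgeFinset] at he
  exact hblack ⟨e, SimpleGraph.edgeSet_mono hT he.1⟩ he.2

theorem treeSum_empty_left
    (hblack : ∀ e : Γ.graph.edgeSet, 0 < Γ.weight e → Γ.weight e = 1) (J : Set (Sym2 V)) :
    Γ.treeSum ∅ J = (Γ.graph.deleteEdges J).numSpanningTrees := by
  classical
  unfold treeSum SimpleGraph.numSpanningTrees
  rw [Finset.sum_congr rfl fun T hT =>
    Γ.blackProduct_eq_one hblack (Finset.mem_filter.1 hT).2.1, Finset.sum_const, nsmul_eq_mul,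
    mul_one]
  congr 2
  ext T
  have h : T ≤ Γ.graph.deleteEdges J ↔ T ≤ Γ.graph ∧ Disjoint J T.edgeSet := by
    rw [← SimpleGraph.edgeSet_subset_edgeSet, SimpleGraph.edgeSet_deleteEdges, Set.subset_sdiff,
      SimpleGraph.edgeSet_subset_edgeSet, disjoint_comm]
  simp only [Finset.mem_filter, Finset.mem_univ, true_and, IsSpanningTreeWith, h,
    Set.empty_subset]
  tauto

/-- The discriminant in terms of the numbers of spanning trees of the graph with red edges
removed. -/
theorem discriminant_eq (hblack : ∀ e : Γ.graph.edgeSet, 0 < Γ.weight e → Γ.weight e = 1)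
    (x y : Sym2 V) :
    Γ.discriminant x y =
      Γ.graph.numSpanningTrees * (Γ.graph.deleteEdges {x, y}).numSpanningTrees -
        (Γ.graph.deleteEdges {x}).numSpanningTrees *
          (Γ.graph.deleteEdges {y}).numSpanningTrees := by
  have h0 := Γ.treeSum_empty_left hblack ∅
  have hx := Γ.treeSum_empty_left hblack {x}
  have hy := Γ.treeSum_empty_left hblack {y}
  have hxy := Γ.treeSum_empty_left hblack {x, y}
  have s1 := Γ.treeSum_eq_add ∅ ∅ y
  have s2 := Γ.treeSum_eq_add {y} ∅ x
  have s3 := Γ.treeSum_eq_add ∅ {y} x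
  have s4 := Γ.treeSum_eq_add ∅ {x} y
  rw [Set.pair_comm y x] at s4
  simp only [insert_empty_eq] at s1 s2 s3 s4
  rw [SimpleGraph.deleteEdges_empty] at h0
  unfold discriminant
  -- What remains is (A₁₁ + A₀₁ + A₁₀ + A₀₀)A₀₀ − (A₀₁ + A₀₀)(A₁₀ + A₀₀) = A₁₁A₀₀ − A₀₁A₁₀.
  rw [← h0, ← hx, ← hy, ← hxy, s1, s2, s4, s3]
  ring

end WeightedGraph

/-! ### The main theorem. -/

theorem mainTheorem4 {V : Type*} [Fintype V] (Γ : WeightedGraph V) [Fintype Γ.graph.edgeSet]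
    (x y : Γ.graph.edgeSet) (hxy : x ≠ y)
    (hred : ∀ e : Γ.graph.edgeSet, Γ.weight e < 0 ↔ e = x ∨ e = y)
    (hblack : ∀ e : Γ.graph.edgeSet, 0 < Γ.weight e → Γ.weight e = 1)
    (hconn : (Γ.graph.deleteEdges {(x : Sym2 V), (y : Sym2 V)}).Connected)
    (k : ℕ) (hk : Fintype.card Γ.graph.edgeSet + 1 = Fintype.card V + (k + 2))
    (o : EdgeOrientation Γ.graph)
    (F : Matrix (Fin (k + 2)) Γ.graph.edgeSet ℤ)
    (hbasis : o.IsCycleBasis (Γ.graph.deleteEdges {(x : Sym2 V), (y : Sym2 V)})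
      (fun i : Fin k => F i.castSucc.castSucc))
    (a : V) (p : Γ.graph.Walk a a) (hp : p.IsCycle)
    (hpx : (x : Sym2 V) ∈ p.edges) (hpy : (y : Sym2 V) ∉ p.edges)
    (hFx : F (Fin.last k).castSucc = o.chain p)
    (b : V) (q : Γ.graph.Walk b b) (hq : q.IsCycle)
    (hqy : (y : Sym2 V) ∈ q.edges) (hqx : (x : Sym2 V) ∉ q.edges)
    (hFy : F (Fin.last (k + 1)) = o.chain q) :
    o.IsCycleBasis Γ.graph (fun i => F i) ∧
      Γ.discriminant x y =
        -((deletedMinor (F * F.transpose) (Fin.last (k + 1)) (Fin.last k).castSucc : ℤ) : ℝ) ^ 2 := by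
  have hxy' : (x : Sym2 V) ≠ y := fun h => hxy (Subtype.ext h)
  have avoids {c : V} (w : Γ.graph.Walk c c) (e : Sym2 V) (he : e ∉ w.edges) :
      o.chain w ∈ o.cycleLattice (Γ.graph.deleteEdges {e}) :=
    o.chain_mem_cycleLattice w _ fun e' he' => by
      rw [SimpleGraph.edgeSet_deleteEdges]
      refine ⟨w.edges_subset_edgeSet he', ?_⟩
      rintro rfl
      exact he he'
  have hy : o.IsCycleBasis (Γ.graph.deleteEdges {(y : Sym2 V)}) (fun i : Fin (k + 1) => F i.castSucc) := by
    refine EdgeOrientation.IsCycleBasis.of_deleteEdges x ?_ ?_ ?_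
    · rwa [SimpleGraph.deleteEdges_deleteEdges, Set.union_comm]
    · rw [hFx]
      exact avoids p y hpy
    · rw [hFx]
      exact o.isUnit_chain p hp.isTrail x hpx
  have hall : o.IsCycleBasis Γ.graph (fun i => F i) := by
    refine EdgeOrientation.IsCycleBasis.of_deleteEdges y hy ?_ ?_
    · rw [hFy]
      exact o.chain_mem_cycleLattice q Γ.graph fun e he => q.edges_subset_edgeSet he
    · rw [hFy]
      exact o.isUnit_chain q hq.isTrail y hqy
  have hskip (i : Fin k) :
      (Fin.last k).castSucc.succAbove i.castSucc = i.castSucc.castSucc :=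
    Fin.succAbove_of_castSucc_lt _ _ (by simp [Fin.lt_def])
  have hskip_last : (Fin.last k).castSucc.succAbove (Fin.last k) = Fin.last (k + 1) := by
    rw [Fin.succAbove_castSucc_self, Fin.succ_last]
  have hx : o.IsCycleBasis (Γ.graph.deleteEdges {(x : Sym2 V)})
      (fun i : Fin (k + 1) => F ((Fin.last k).castSucc.succAbove i)) := by
    refine EdgeOrientation.IsCycleBasis.of_deleteEdges y ?_ ?_ ?_
    · simp only [hskip]
      rwa [SimpleGraph.deleteEdges_deleteEdges]
    · rw [hskip_last, hFy]
      exact avoids q x hqx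
    · rw [hskip_last, hFy]
      exact o.isUnit_chain q hq.isTrail y hqy
  refine ⟨hall, ?_⟩
  have hGcard : Γ.graph.edgeSet.ncard + 1 = Fintype.card V + (k + 2) := by
    rwa [← Nat.card_coe_set_eq, Nat.card_eq_fintype_card]
  have hcard (S : Set (Sym2 V)) (hS : S ⊆ Γ.graph.edgeSet) :
      (Γ.graph.deleteEdges S).edgeSet.ncard + S.ncard = Γ.graph.edgeSet.ncard := by
    rw [SimpleGraph.edgeSet_deleteEdges]
    exact Set.ncard_sdiff_add_ncard_of_subset hS
  have hcx := hcard {(x : Sym2 V)} (by simp)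
  have hcy := hcard {(y : Sym2 V)} (by simp)
  have hcxy := hcard {(x : Sym2 V), (y : Sym2 V)} (by simp [Set.insert_subset_iff])
  rw [Set.ncard_singleton] at hcx hcy
  rw [Set.ncard_pair hxy'] at hcxy
  have dG := hall.det_mul_transpose (B := F) le_rfl (hconn.mono (SimpleGraph.deleteEdges_le _))
    (by simpa using hGcard)
  have dx := hx.det_mul_transpose (B := F.submatrix (Fin.last k).castSucc.succAbove id)
    (SimpleGraph.deleteEdges_le _) (hconn.mono (SimpleGraph.deleteEdges_anti (by simp)))
    (by rw [Fintype.card_fin]; omega)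
  -- This presents the row selection in the form in which it occurs in the minors.
  rw [← Fin.succAbove_last] at hy
  have dy := hy.det_mul_transpose (B := F.submatrix (Fin.last (k + 1)).succAbove id)
    (SimpleGraph.deleteEdges_le _) (hconn.mono (SimpleGraph.deleteEdges_anti (by simp)))
    (by rw [Fintype.card_fin]; omega)
  have dxy := hbasis.det_mul_transpose (B := F.submatrix (fun i : Fin k => i.castSucc.castSucc) id)
    (SimpleGraph.deleteEdges_le _) hconn (by rw [Fintype.card_fin]; omega)
  have hsub {m : ℕ} (r s : Fin m → Fin (k + 2)) :
      (F * F.transpose).submatrix r s = F.submatrix r id * (F.submatrix s id).transpose := rfl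
  have hpos := (hconn.mono (SimpleGraph.deleteEdges_le _)).numSpanningTrees_pos
  have hsymm : ((F * F.transpose).submatrix (Fin.last k).castSucc.succAbove
      (Fin.last (k + 1)).succAbove).det =
      deletedMinor (F * F.transpose) (Fin.last (k + 1)) (Fin.last k).castSucc := by
    rw [deletedMinor, ← Matrix.det_transpose, Matrix.transpose_submatrix, Matrix.transpose_mul,
      Matrix.transpose_transpose]
  -- The Gram determinant is nonzero because a connected graph has a spanning tree.
  have hjac := Matrix.det_mul_det_submatrix_castSucc_castSucc (F * F.transpose)
    (by rw [dG]; exact_mod_cast hpos.ne')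
  have hminor : ((F * F.transpose).submatrix (Fin.last (k + 1)).succAbove
      (Fin.last k).castSucc.succAbove).det =
      deletedMinor (F * F.transpose) (Fin.last (k + 1)) (Fin.last k).castSucc := rfl
  rw [hsymm, hminor, hsub (fun i : Fin k => i.castSucc.castSucc), dG, dxy,
    hsub (Fin.last k).castSucc.succAbove, dx, hsub (Fin.last (k + 1)).succAbove, dy] at hjac
  rw [Γ.discriminant_eq hblack]
  have h := congrArg (Int.cast : ℤ → ℝ) hjac
  push_cast at h
  rw [h]
  ring
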